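/- There is a universal constant $C$ such that the following holds. Let $d$ be a dimension, let $\gamma,\lambda,M\in(0,\infty)$, and let $\mu,\tilde\mu$ be two probability measures on $\mathbf{R}^d$ whose supports are contained in a common closed Euclidean ball of diameter $M$. For $\nu\in\{\mu,\tilde\mu\}$ the functional $$J_{\nu,\lambda,\gamma}(u)=\int|u(x)-x|^2\,\mathrm{d}\nu(x)+\lambda\gamma^{d+1}\iint e^{-\gamma|x-y|}|u(x)-u(y)|\,\mathrm{d}\nu(x)\,\mathrm{d}\nu(y)$$ has a unique minimizer $u_{\nu,\lambda,\gamma}$ in $(L^2(\nu))^d$. Let $$\mathcal{W}_\infty(\mu,\tilde\mu)=\inf_\pi\operatorname*{ess\,sup}_{(x,\tilde x)\sim\pi}|x-\tilde x|,$$ where the infimum is over all couplings $\pi$ of $\mu$ and $\tilde\mu$; a coupling attaining it is called an $\infty$-optimal transport plan. Then there is an $\infty$-optimal transport plan $\pi$ from $\mu$ to $\tilde\mu$ such that $$\int|u_{\mu,\lambda,\gamma}(x)-u_{\tilde\mu,\lambda,\gamma}(\tilde x)|^2\,\mathrm{d}\pi(x,\tilde x)\le C(M+1)^2\max\{\gamma,1\}\,\mathcal{W}_\infty(\mu,\tilde\mu).$$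 In particular, for every $\gamma\ge1$ the right-hand side is $C(M+1)^2\gamma\,\mathcal{W}_\infty(\mu,\tilde\mu)$. -/

import Mathlib

open MeasureTheory
open scoped ENNReal

namespace SumOfNorms

noncomputable section

/-- Euclidean space `ℝᵈ` (with the Euclidean norm and the Borel σ-algebra). -/
abbrev E (d : ℕ) : Type := EuclideanSpace ℝ (Fin d)

/-- The space `(L²(μ))ᵈ` of square integrable maps `ℝᵈ → ℝᵈ`, up to `μ`-a.e. equality. -/
abbrev L2 {d : ℕ} (μ : Measure (E d)) : Type := Lp (E d) 2 μ

/-- The weighted sum-of-norms clustering functional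
`J(u) = ∫ |u(x) - x|² dμ(x) + λ γ^(d+1) ∬ exp(-γ |x - y|) |u(x) - u(y)| dμ(x) dμ(y)`. -/
def J {d : ℕ} (μ : Measure (E d)) (lam γ : ℝ) (u : L2 μ) : ℝ :=
  (∫ x, ‖u x - x‖ ^ 2 ∂μ) +
    lam * γ ^ (d + 1) *
      ∫ x, ∫ y, Real.exp (-(γ * ‖x - y‖)) * ‖u x - u y‖ ∂μ ∂μ

/-- `u` is a minimizer of the functional over all of `(L²(μ))ᵈ`. -/
def IsMinimizer {d : ℕ} (μ : Measure (E d)) (lam γ : ℝ) (u : L2 μ) : Prop :=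
  ∀ v : L2 μ, J μ lam γ u ≤ J μ lam γ v

/-- `π` is a coupling of `μ` and `ν`: its marginals are `μ` and `ν`. -/
def IsCoupling {d : ℕ} (μ ν : Measure (E d)) (π : Measure (E d × E d)) : Prop :=
  π.map Prod.fst = μ ∧ π.map Prod.snd = ν

/-- The essential supremum of `|x - y|` for `(x, y)` distributed according to `π`. -/
def supCost {d : ℕ} (π : Measure (E d × E d)) : ℝ≥0∞ :=
  essSup (fun p => edist p.1 p.2) π

/-- The `∞`-Wasserstein distance, the infimum over all couplings of the supremal cost. -/
def winfty {d : ℕ} (μ ν : Measure (E d)) : ℝ≥0∞ :=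
  ⨅ (π : Measure (E d × E d)) (_ : IsCoupling μ ν π), supCost π

/-- An `∞`-optimal transport plan is a coupling that attains the `∞`-Wasserstein distance. -/
def IsOptimalPlan {d : ℕ} (μ ν : Measure (E d)) (π : Measure (E d × E d)) : Prop :=
  IsCoupling μ ν π ∧ supCost π = winfty μ ν

end

end SumOfNorms

/-! Both problems are lifted to one plan `π` and compared there. A pair `p` carries the position
`p.1` for the first functional and `p.2` for the second, giving two energies of fields on the same
space `L²(π)`. Averaging a field over the fibres of `π` does not raise its energy, by conditional
Jensen (`energy_integral_condKernel_le`), so `u ∘ Prod.fst` and `u' ∘ Prod.snd` minimize the lifted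
energies over all fields of pairs.

If `π` moves points by at most `δ`, then for `2γδ ≤ 1` the two energies of either minimizer differ
by `O(δ max(γ,1) (M+1)²)` (`energy_le_of_norm_sub_le`): the interaction weights change by a factor
at most `exp(2γδ)`, and the whole interaction term, prefactor `λγ^(d+1)` included, is at most the
energy, hence at most `(M/2)²`. This makes the constant independent of `λ` and `d`. Strong convexity
(`energy_midpoint_le`) turns the energy gap into an `L²(π)` distance. For `2γδ > 1` a crude bound
suffices.

Optimality of `π` serves only to take `δ = W_∞`; such a plan exists by compactness and lower
semicontinuity. -/

namespace SumOfNorms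

/-! ### The functional with general positions: invariance, convexity, continuity -/

section Energy

variable {Ω Ω' V : Type*} [MeasurableSpace Ω] [MeasurableSpace Ω']
  [NormedAddCommGroup V]

/-- The sum-of-norms functional of a field `w` on a probability space whose points `x` sit at the
positions `P x`. -/
noncomputable def energy (ρ : Measure Ω) (P : Ω → V) (a γ : ℝ) (w : Ω → V) : ℝ :=
  (∫ x, ‖w x - P x‖ ^ 2 ∂ρ) +
    a * ∫ q, Real.exp (-(γ * ‖P q.1 - P q.2‖)) * ‖w q.1 - w q.2‖ ∂(ρ.prod ρ)

lemma exp_weight_le_one {γ : ℝ} (hγ : 0 ≤ γ) (z : V) : Real.exp (-(γ * ‖z‖)) ≤ 1 :=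
  Real.exp_le_one_iff.2 (neg_nonpos.2 (by positivity))

lemma aestronglyMeasurable_weight {ρ : Measure Ω} {ρ' : Measure Ω'} [SFinite ρ]
    [SFinite ρ'] (γ : ℝ) {P : Ω → V} {Q : Ω' → V}
    (hP : AEStronglyMeasurable P ρ) (hQ : AEStronglyMeasurable Q ρ') :
    AEStronglyMeasurable (fun q : Ω × Ω' => Real.exp (-(γ * ‖P q.1 - Q q.2‖))) (ρ.prod ρ') :=
  Real.continuous_exp.comp_aestronglyMeasurable
    (((hP.comp_fst.sub hQ.comp_snd).norm.const_mul γ).neg)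

lemma integrable_weight_mul {ρ : Measure Ω} {ρ' : Measure Ω'} [IsFiniteMeasure ρ]
    [IsFiniteMeasure ρ'] {γ : ℝ} (hγ : 0 ≤ γ) {P f : Ω → V} {Q g : Ω' → V}
    (hP : AEStronglyMeasurable P ρ) (hQ : AEStronglyMeasurable Q ρ')
    (hf : Integrable f ρ) (hg : Integrable g ρ') :
    Integrable (fun q : Ω × Ω' => Real.exp (-(γ * ‖P q.1 - Q q.2‖)) * ‖f q.1 - g q.2‖)
      (ρ.prod ρ') := by
  refine ((hf.comp_fst ρ').sub (hg.comp_snd ρ)).norm.bdd_mul (c := 1)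
    (aestronglyMeasurable_weight γ hP hQ) (Filter.Eventually.of_forall fun q => ?_)
  rw [Real.norm_of_nonneg (Real.exp_nonneg _)]
  exact exp_weight_le_one hγ _

lemma integrable_normSq_sub {ρ : Measure Ω} {f g : Ω → V} (hf : MemLp f 2 ρ) (hg : MemLp g 2 ρ) :
    Integrable (fun x => ‖f x - g x‖ ^ 2) ρ :=
  (memLp_two_iff_integrable_sq_norm (hf.sub hg).1).1 (hf.sub hg)

lemma energy_nonneg (ρ : Measure Ω) (P : Ω → V) {a : ℝ} (ha : 0 ≤ a) (γ : ℝ) (w : Ω → V) :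
    0 ≤ energy ρ P a γ w := by
  unfold energy
  positivity

lemma integral_normSq_le_energy (ρ : Measure Ω) (P : Ω → V) {a : ℝ} (ha : 0 ≤ a) (γ : ℝ)
    (w : Ω → V) : ∫ x, ‖w x - P x‖ ^ 2 ∂ρ ≤ energy ρ P a γ w := by
  refine le_add_of_nonneg_right (mul_nonneg ha (integral_nonneg fun q => ?_))
  positivity

lemma energy_const (ρ : Measure Ω) (P : Ω → V) (a γ : ℝ) (c : V) :
    energy ρ P a γ (fun _ => c) = ∫ x, ‖c - P x‖ ^ 2 ∂ρ := by
  simp [energy]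

lemma energy_comp {ρ : Measure Ω} {ρ' : Measure Ω'} [SFinite ρ] [SFinite ρ'] {f : Ω → Ω'}
    (hf : MeasurePreserving f ρ ρ') {P w : Ω' → V} (a γ : ℝ)
    (hP : AEStronglyMeasurable P ρ') (hw : AEStronglyMeasurable w ρ') :
    energy ρ (P ∘ f) a γ (w ∘ f) = energy ρ' P a γ w := by
  have h1 : ∫ x, ‖w x - P x‖ ^ 2 ∂ρ' = ∫ x, ‖w (f x) - P (f x)‖ ^ 2 ∂ρ := by
    rw [← hf.map_eq]
    exact integral_map hf.aemeasurable (by rw [hf.map_eq]; exact ((hw.sub hP).norm.pow 2))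
  have hff := hf.prod hf
  have h2 : ∫ q, Real.exp (-(γ * ‖P q.1 - P q.2‖)) * ‖w q.1 - w q.2‖ ∂(ρ'.prod ρ') =
      ∫ q, Real.exp (-(γ * ‖P (f q.1) - P (f q.2)‖)) * ‖w (f q.1) - w (f q.2)‖ ∂(ρ.prod ρ) := by
    rw [← hff.map_eq]
    refine integral_map hff.aemeasurable ?_
    rw [hff.map_eq]
    exact (aestronglyMeasurable_weight γ hP hP).mul (hw.comp_fst.sub hw.comp_snd).norm
  unfold energy
  rw [h1, h2]
  rfl

lemma energy_congr {ρ : Measure Ω} [SFinite ρ] {P u v : Ω → V} {a γ : ℝ} (h : u =ᵐ[ρ] v) :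
    energy ρ P a γ u = energy ρ P a γ v := by
  have h1 : ∫ x, ‖u x - P x‖ ^ 2 ∂ρ = ∫ x, ‖v x - P x‖ ^ 2 ∂ρ :=
    integral_congr_ae (by filter_upwards [h] with x hx; rw [hx])
  have h2 : ∫ q, Real.exp (-(γ * ‖P q.1 - P q.2‖)) * ‖u q.1 - u q.2‖ ∂(ρ.prod ρ) =
      ∫ q, Real.exp (-(γ * ‖P q.1 - P q.2‖)) * ‖v q.1 - v q.2‖ ∂(ρ.prod ρ) := by
    refine integral_congr_ae ?_
    filter_upwards [Measure.quasiMeasurePreserving_fst.ae h,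
      Measure.quasiMeasurePreserving_snd.ae h] with q h1 h2
    rw [h1, h2]
  unfold energy
  rw [h1, h2]

variable [InnerProductSpace ℝ V]

/-- The energy is strongly convex along midpoints. -/
lemma energy_midpoint_le {ρ : Measure Ω} [IsFiniteMeasure ρ] {P u v : Ω → V} {a γ : ℝ}
    (ha : 0 ≤ a) (hγ : 0 ≤ γ) (hP : MemLp P 2 ρ) (hu : MemLp u 2 ρ) (hv : MemLp v 2 ρ) :
    energy ρ P a γ (fun x => (2⁻¹ : ℝ) • (u x + v x)) ≤
      (energy ρ P a γ u + energy ρ P a γ v) / 2 - (∫ x, ‖u x - v x‖ ^ 2 ∂ρ) / 4 := by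
  have iu := hu.integrable one_le_two
  have iv := hv.integrable one_le_two
  have ku := integrable_weight_mul hγ hP.1 hP.1 iu iu
  have kv := integrable_weight_mul hγ hP.1 hP.1 iv iv
  have km := integrable_weight_mul hγ hP.1 hP.1 ((iu.add iv).smul (2⁻¹ : ℝ))
    ((iu.add iv).smul (2⁻¹ : ℝ))
  -- The parallelogram law makes the fidelity term exact; it supplies all of the strong convexity,
  -- the interaction being merely convex.
  have h1 : ∫ x, ‖(2⁻¹ : ℝ) • (u x + v x) - P x‖ ^ 2 ∂ρ =
      ((∫ x, ‖u x - P x‖ ^ 2 ∂ρ) + ∫ x, ‖v x - P x‖ ^ 2 ∂ρ) / 2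
        - (∫ x, ‖u x - v x‖ ^ 2 ∂ρ) / 4 := by
    rw [← integral_add (integrable_normSq_sub hu hP) (integrable_normSq_sub hv hP),
      ← integral_div, ← integral_div,
      ← integral_sub (f := fun x => (‖u x - P x‖ ^ 2 + ‖v x - P x‖ ^ 2) / 2)
        (((integrable_normSq_sub hu hP).add (integrable_normSq_sub hv hP)).div_const 2)
        ((integrable_normSq_sub hu hv).div_const 4)]
    refine integral_congr_ae (Filter.Eventually.of_forall fun x => ?_)
    have e1 : (2⁻¹ : ℝ) • (u x + v x) - P x = (2⁻¹ : ℝ) • ((u x - P x) + (v x - P x)) := by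
      module
    have e2 : u x - v x = (u x - P x) - (v x - P x) := by abel
    have := parallelogram_law_with_norm ℝ (u x - P x) (v x - P x)
    rw [← e2] at this
    simp only
    rw [e1, norm_smul, mul_pow]
    norm_num
    linarith
  have h2 : ∫ q, Real.exp (-(γ * ‖P q.1 - P q.2‖)) *
        ‖(2⁻¹ : ℝ) • (u q.1 + v q.1) - (2⁻¹ : ℝ) • (u q.2 + v q.2)‖ ∂(ρ.prod ρ) ≤
      ((∫ q, Real.exp (-(γ * ‖P q.1 - P q.2‖)) * ‖u q.1 - u q.2‖ ∂(ρ.prod ρ)) +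
        ∫ q, Real.exp (-(γ * ‖P q.1 - P q.2‖)) * ‖v q.1 - v q.2‖ ∂(ρ.prod ρ)) / 2 := by
    rw [← integral_add ku kv, ← integral_div]
    refine integral_mono km ((ku.add kv).div_const 2) fun q => ?_
    have e1 : (2⁻¹ : ℝ) • (u q.1 + v q.1) - (2⁻¹ : ℝ) • (u q.2 + v q.2) =
        (2⁻¹ : ℝ) • ((u q.1 - u q.2) + (v q.1 - v q.2)) := by module
    have h := norm_add_le (u q.1 - u q.2) (v q.1 - v q.2)
    simp only
    rw [e1, norm_smul, ← mul_add, mul_div_assoc]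
    refine mul_le_mul_of_nonneg_left ?_ (Real.exp_nonneg _)
    norm_num
    linarith
  unfold energy
  rw [h1]
  have := mul_le_mul_of_nonneg_left h2 ha
  linarith

/-- The energy is a continuous functional on `L²`. -/
lemma continuous_energy {ρ : Measure Ω} [IsProbabilityMeasure ρ] {P : Ω → V} (a : ℝ) {γ : ℝ}
    (hγ : 0 ≤ γ) (hP : MemLp P 2 ρ) :
    Continuous fun u : Lp V 2 ρ => energy ρ P a γ u := by
  have h1 : (fun u : Lp V 2 ρ => ∫ x, ‖u x - P x‖ ^ 2 ∂ρ) =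
      fun u => ‖u - hP.toLp P‖ ^ 2 := by
    ext u
    rw [← real_inner_self_eq_norm_sq, L2.inner_def]
    refine integral_congr_ae ?_
    filter_upwards [Lp.coeFn_sub u (hP.toLp P), hP.coeFn_toLp] with x h1 h2
    rw [h1, Pi.sub_apply, h2, real_inner_self_eq_norm_sq]
  have h2 : Continuous fun u : Lp V 2 ρ =>
      ∫ q, Real.exp (-(γ * ‖P q.1 - P q.2‖)) * ‖u q.1 - u q.2‖ ∂(ρ.prod ρ) := by
    -- The factor 2 counts the two variables of the double integral; the `L¹` norm is at most the
    -- `L²` norm on a probability space.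
    refine (LipschitzWith.of_dist_le_mul (K := 2) fun u v => ?_).continuous
    have iu := (Lp.memLp u).integrable one_le_two
    have iv := (Lp.memLp v).integrable one_le_two
    have ku := integrable_weight_mul hγ hP.1 hP.1 iu iu
    have kv := integrable_weight_mul hγ hP.1 hP.1 iv iv
    have id : Integrable (fun x => ‖u x - v x‖) ρ := (iu.sub iv).norm
    have hsq : ∫ x, ‖u x - v x‖ ∂ρ ≤ dist u v := by
      rw [dist_eq_norm, Lp.norm_def, ← eLpNorm_congr_ae (Lp.coeFn_sub u v).symm]
      have : ∫ x, ‖u x - v x‖ ∂ρ = (eLpNorm (⇑u - ⇑v) 1 ρ).toReal := by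
        rw [eLpNorm_one_eq_lintegral_enorm, ← integral_norm_eq_lintegral_enorm (iu.sub iv).1]
        rfl
      rw [this]
      exact ENNReal.toReal_mono ((Lp.memLp u).sub (Lp.memLp v)).2.ne
        (eLpNorm_le_eLpNorm_of_exponent_le one_le_two (iu.sub iv).1)
    rw [Real.dist_eq, ← integral_sub ku kv]
    refine (abs_integral_le_integral_abs).trans ?_
    calc _ ≤ ∫ q : Ω × Ω, ‖u q.1 - v q.1‖ + ‖u q.2 - v q.2‖ ∂(ρ.prod ρ) := by
          refine integral_mono (ku.sub kv).abs ((id.comp_fst ρ).add (id.comp_snd ρ)) fun q => ?_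
          simp only
          rw [← mul_sub, abs_mul, abs_of_nonneg (Real.exp_nonneg _)]
          refine (mul_le_of_le_one_left (abs_nonneg _) (exp_weight_le_one hγ _)).trans ?_
          refine (abs_norm_sub_norm_le _ _).trans ?_
          rw [sub_sub_sub_comm]
          exact norm_sub_le _ _
      _ = 2 * ∫ x, ‖u x - v x‖ ∂ρ := by
          have e1 := integral_fun_fst (μ := ρ) (ν := ρ) (fun x => ‖u x - v x‖)
          have e2 := integral_fun_snd (μ := ρ) (ν := ρ) (fun x => ‖u x - v x‖)
          rw [integral_add (id.comp_fst ρ) (id.comp_snd ρ)]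
          rw [e1, e2]
          simp [two_mul]
      _ ≤ _ := by
          push_cast
          linarith
  unfold energy
  refine Continuous.add ?_ (h2.const_mul a)
  rw [h1]
  fun_prop

end Energy

/-- A nonnegative continuous functional on a complete space that is strongly convex along
midpoints has a unique minimizer. -/
lemma existsUnique_forall_le_of_midpoint {H : Type*} [NormedAddCommGroup H] [CompleteSpace H]
    [NormedSpace ℝ H] {f : H → ℝ} (hf : Continuous f) (h0 : ∀ x, 0 ≤ f x)
    (hm : ∀ x y, f ((2⁻¹ : ℝ) • (x + y)) ≤ (f x + f y) / 2 - ‖x - y‖ ^ 2 / 4) :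
    ∃! x, ∀ y, f x ≤ f y := by
  have hb : BddBelow (Set.range f) := ⟨0, by rintro _ ⟨x, rfl⟩; exact h0 x⟩
  set m := ⨅ x, f x
  have hle : ∀ x, m ≤ f x := fun x => ciInf_le hb x
  -- The midpoint has value at least `m`, so near-minimizers are close: this gives both the Cauchy
  -- property and uniqueness.
  have hdist : ∀ x y, ‖x - y‖ ^ 2 ≤ 2 * (f x - m) + 2 * (f y - m) := fun x y => by
    linarith [hm x y, hle ((2⁻¹ : ℝ) • (x + y))]
  have hseq : ∀ n : ℕ, ∃ x, f x < m + 1 / ((n : ℝ) + 1) := fun n =>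
    exists_lt_of_ciInf_lt (lt_add_of_pos_right _ (by positivity))
  choose x hx using hseq
  have hcau : CauchySeq x := by
    rw [Metric.cauchySeq_iff']
    intro ε hε
    obtain ⟨N, hN⟩ := exists_nat_one_div_lt (show (0 : ℝ) < ε ^ 2 / 4 by positivity)
    refine ⟨N, fun n hn => ?_⟩
    have h1 : 1 / ((n : ℝ) + 1) ≤ 1 / ((N : ℝ) + 1) := Nat.one_div_le_one_div hn
    rw [dist_eq_norm]
    refine lt_of_pow_lt_pow_left₀ 2 hε.le ?_
    linarith [hdist (x n) (x N), hx n, hx N]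
  obtain ⟨z, hz⟩ := cauchySeq_tendsto_of_complete hcau
  have hzm : f z ≤ m := by
    refine le_of_tendsto_of_tendsto ((hf.tendsto z).comp hz) (?_ : Filter.Tendsto
      (fun n : ℕ => m + 1 / ((n : ℝ) + 1)) Filter.atTop (nhds m))
      (Filter.Eventually.of_forall fun n => (hx n).le)
    simpa using tendsto_one_div_add_atTop_nhds_zero_nat.const_add m
  refine ⟨z, fun y => hzm.trans (hle y), fun y hy => ?_⟩
  have h1 := hdist y z
  have h2 : ‖y - z‖ ^ 2 ≤ 0 := by linarith [hy z]
  rw [← sub_eq_zero, ← norm_eq_zero]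
  exact pow_eq_zero_iff two_ne_zero |>.1 (le_antisymm h2 (sq_nonneg _))

/-! ### Existence, uniqueness and energy bound for minimizers -/

section Minimizer

variable {d : ℕ} {μ : Measure (E d)}

lemma J_eq_energy [IsProbabilityMeasure μ] {lam γ : ℝ} (hγ : 0 ≤ γ) (u : L2 μ) :
    J μ lam γ u = energy μ id (lam * γ ^ (d + 1)) γ u := by
  have iu := (Lp.memLp u).integrable one_le_two
  have hP : AEStronglyMeasurable (id : E d → E d) μ := aestronglyMeasurable_id
  have := integral_prod _ (integrable_weight_mul hγ hP hP iu iu)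
  unfold J energy
  rw [this]
  rfl

lemma ae_mem_of_support_subset {c : E d} {r : ℝ} (h : μ.support ⊆ Metric.closedBall c r) :
    ∀ᵐ x ∂μ, ‖c - x‖ ≤ r := by
  filter_upwards [Measure.support_mem_ae (μ := μ)] with x hx
  rw [← dist_eq_norm, dist_comm]
  exact h hx

lemma memLp_id_of_ae_le [IsFiniteMeasure μ] {c : E d} {r : ℝ} (h : ∀ᵐ x ∂μ, ‖c - x‖ ≤ r) :
    MemLp (id : E d → E d) 2 μ := by
  refine MemLp.of_bound aestronglyMeasurable_id (‖c‖ + r) ?_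
  filter_upwards [h] with x hx
  have : x = c - (c - x) := by abel
  calc ‖x‖ = ‖c - (c - x)‖ := by rw [← this]
    _ ≤ ‖c‖ + ‖c - x‖ := norm_sub_le _ _
    _ ≤ _ := by gcongr

lemma existsUnique_isMinimizer [IsProbabilityMeasure μ] {lam γ : ℝ} (hγ : 0 ≤ γ) (hlam : 0 ≤ lam)
    (hid : MemLp (id : E d → E d) 2 μ) : ∃! u : L2 μ, IsMinimizer μ lam γ u := by
  have ha : 0 ≤ lam * γ ^ (d + 1) := by positivity
  refine existsUnique_forall_le_of_midpoint (f := J μ lam γ) ?_ (fun u => ?_) fun u v => ?_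
  · rw [funext (J_eq_energy (μ := μ) (lam := lam) hγ)]
    exact continuous_energy _ hγ hid
  · rw [J_eq_energy hγ]
    exact energy_nonneg _ _ ha _ _
  · have hm := energy_midpoint_le ha hγ hid (Lp.memLp u) (Lp.memLp v)
    have hc : ((2⁻¹ : ℝ) • (u + v) : L2 μ) =ᵐ[μ] fun x => (2⁻¹ : ℝ) • (u x + v x) := by
      filter_upwards [Lp.coeFn_smul (2⁻¹ : ℝ) (u + v), Lp.coeFn_add u v] with x h1 h2
      rw [h1, Pi.smul_apply, h2, Pi.add_apply]
    have hn : ‖u - v‖ ^ 2 = ∫ x, ‖u x - v x‖ ^ 2 ∂μ := by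
      rw [← real_inner_self_eq_norm_sq, L2.inner_def]
      refine integral_congr_ae ?_
      filter_upwards [Lp.coeFn_sub u v] with x h1
      rw [h1, Pi.sub_apply, real_inner_self_eq_norm_sq]
    rw [J_eq_energy hγ, J_eq_energy hγ, J_eq_energy hγ, hn, energy_congr hc]
    exact hm

lemma IsMinimizer.le_of_memLp [IsProbabilityMeasure μ] {lam γ : ℝ} (hγ : 0 ≤ γ) {u : L2 μ}
    (hu : IsMinimizer μ lam γ u) {v : E d → E d} (hv : MemLp v 2 μ) :
    energy μ id (lam * γ ^ (d + 1)) γ u ≤ energy μ id (lam * γ ^ (d + 1)) γ v := by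
  have := hu (hv.toLp v)
  rwa [J_eq_energy hγ, J_eq_energy hγ, energy_congr hv.coeFn_toLp] at this

/-- The competitor is the constant field `c`, whose interaction term vanishes. -/
lemma IsMinimizer.energy_le [IsProbabilityMeasure μ] {lam γ : ℝ} (hγ : 0 ≤ γ) {u : L2 μ}
    (hu : IsMinimizer μ lam γ u) {c : E d} {r : ℝ} (h : ∀ᵐ x ∂μ, ‖c - x‖ ≤ r) :
    energy μ id (lam * γ ^ (d + 1)) γ u ≤ r ^ 2 := by
  refine (hu.le_of_memLp hγ (memLp_const c)).trans ?_
  rw [energy_const]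
  have hb : ∀ᵐ x ∂μ, ‖c - id x‖ ^ 2 ≤ r ^ 2 := by
    filter_upwards [h] with x hx
    exact pow_le_pow_left₀ (norm_nonneg _) hx 2
  calc _ ≤ ∫ _, r ^ 2 ∂μ := integral_mono_ae
        (integrable_normSq_sub (memLp_const c) (memLp_id_of_ae_le h)) (integrable_const _) hb
    _ = r ^ 2 := by simp

end Minimizer

/-! ### Averaging over the fibres of a plan -/

section Averaging

/-- Conditional Jensen inequality: averaging `w` over the second coordinate decreases the
integral of a convex function. -/
lemma integral_condKernel_le_of_convexOn {d : ℕ} {π : Measure (E d × E d)} [IsProbabilityMeasure π]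
    {w : E d × E d → E d} (hw : Integrable w π) {Φ : E d → E d → ℝ}
    (hconv : ∀ x, ConvexOn ℝ Set.univ (Φ x)) (hcont : ∀ x, Continuous (Φ x))
    (hΦ : Integrable (fun p => Φ p.1 (w p)) π)
    (hΦv : Integrable (fun x => Φ x (∫ y, w (x, y) ∂π.condKernel x)) π.fst) :
    ∫ x, Φ x (∫ y, w (x, y) ∂π.condKernel x) ∂π.fst ≤ ∫ p, Φ p.1 (w p) ∂π := by
  have hint : Integrable (fun x => ∫ y, Φ x (w (x, y)) ∂π.condKernel x) π.fst :=
    hΦ.integral_condKernel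
  calc _ ≤ ∫ x, ∫ y, Φ x (w (x, y)) ∂π.condKernel x ∂π.fst := by
        refine integral_mono_ae hΦv hint ?_
        filter_upwards [hw.condKernel_ae, hΦ.condKernel_ae] with x h1 h2
        exact (hconv x).map_integral_le (hcont x).continuousOn isClosed_univ
          (Filter.Eventually.of_forall fun _ => Set.mem_univ _) h1 h2
    _ = _ := Measure.integral_condKernel hΦ

lemma memLp_integral_condKernel {d : ℕ} {π : Measure (E d × E d)} [IsProbabilityMeasure π]
    {w : E d × E d → E d} (hw : MemLp w 2 π) :
    MemLp (fun x => ∫ y, w (x, y) ∂π.condKernel x) 2 π.fst := by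
  have hsm := hw.1.integral_condKernel
  have iw := hw.integrable one_le_two
  have iw2 := (memLp_two_iff_integrable_sq_norm hw.1).1 hw
  refine (memLp_two_iff_integrable_sq_norm hsm).2 (iw2.integral_condKernel.mono' (hsm.norm.pow 2) ?_)
  filter_upwards [iw.condKernel_ae, iw2.condKernel_ae] with x h1 h2
  rw [Real.norm_of_nonneg (by positivity)]
  refine (pow_le_pow_left₀ (norm_nonneg _) (norm_integral_le_integral_norm _) 2).trans ?_
  exact (even_two.convexOn_pow (𝕜 := ℝ)).map_integral_le (by fun_prop) isClosed_univ
    (Filter.Eventually.of_forall fun _ => Set.mem_univ _) h1.norm h2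

/-- The weight sees only first coordinates, so it is constant on fibres and Jensen applies to the
interaction one variable at a time, through a mixed integral over `π.fst.prod π`. -/
lemma energy_integral_condKernel_le {d : ℕ} {π : Measure (E d × E d)} [IsProbabilityMeasure π]
    {a γ : ℝ} (ha : 0 ≤ a) (hγ : 0 ≤ γ) (hid : MemLp (id : E d → E d) 2 π.fst)
    {w : E d × E d → E d} (hw : MemLp w 2 π) :
    energy π.fst id a γ (fun x => ∫ y, w (x, y) ∂π.condKernel x) ≤ energy π Prod.fst a γ w := by
  set v : E d → E d := fun x => ∫ y, w (x, y) ∂π.condKernel x with hvdef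
  have hv : MemLp v 2 π.fst := memLp_integral_condKernel hw
  have iw := hw.integrable one_le_two
  have iv := hv.integrable one_le_two
  have hfst : MeasurePreserving Prod.fst π π.fst := ⟨measurable_fst, rfl⟩
  have hP : MemLp (Prod.fst : E d × E d → E d) 2 π := hid.comp_measurePreserving hfst
  have hconv : ∀ z : E d, ConvexOn ℝ Set.univ fun y : E d => ‖y - z‖ := fun z => by
    simpa only [sub_eq_add_neg, Function.comp_def, Set.preimage_univ] using (convexOn_univ_norm (E := E d)).translate_left (-z)
  have hconv' : ∀ z : E d, ConvexOn ℝ Set.univ fun y : E d => ‖z - y‖ := fun z => by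
    simpa [norm_sub_rev] using hconv z
  have h1 : ∫ x, ‖v x - id x‖ ^ 2 ∂π.fst ≤ ∫ p, ‖w p - p.1‖ ^ 2 ∂π :=
    integral_condKernel_le_of_convexOn iw (Φ := fun x y => ‖y - x‖ ^ 2)
      (fun x => (hconv x).pow (fun _ _ => norm_nonneg _) 2) (fun x => by fun_prop)
      (integrable_normSq_sub hw hP) (integrable_normSq_sub hv hid)
  have kvv := integrable_weight_mul hγ hid.1 hid.1 iv iv
  have kvw := integrable_weight_mul hγ hid.1 hP.1 iv iw
  have kww := integrable_weight_mul hγ hP.1 hP.1 iw iw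
  have h2 : ∫ q, Real.exp (-(γ * ‖id q.1 - id q.2‖)) * ‖v q.1 - v q.2‖ ∂(π.fst.prod π.fst) ≤
      ∫ q : E d × (E d × E d), Real.exp (-(γ * ‖id q.1 - q.2.1‖)) * ‖v q.1 - w q.2‖
        ∂(π.fst.prod π) := by
    rw [integral_prod _ kvv, integral_prod _ kvw]
    refine integral_mono_ae kvv.integral_prod_left kvw.integral_prod_left ?_
    filter_upwards [kvv.prod_right_ae, kvw.prod_right_ae] with x hx1 hx2
    exact integral_condKernel_le_of_convexOn iw
      (Φ := fun y z => Real.exp (-(γ * ‖x - y‖)) * ‖v x - z‖)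
      (fun y => (hconv' (v x)).smul (Real.exp_nonneg _)) (fun y => by fun_prop) hx2 hx1
  have h3 : ∫ q : E d × (E d × E d), Real.exp (-(γ * ‖id q.1 - q.2.1‖)) * ‖v q.1 - w q.2‖
        ∂(π.fst.prod π) ≤
      ∫ q, Real.exp (-(γ * ‖q.1.1 - q.2.1‖)) * ‖w q.1 - w q.2‖ ∂(π.prod π) := by
    rw [integral_prod_symm _ kvw, integral_prod_symm _ kww]
    refine integral_mono_ae kvw.integral_prod_right kww.integral_prod_right ?_
    filter_upwards [kvw.prod_left_ae, kww.prod_left_ae] with p hp1 hp2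
    exact integral_condKernel_le_of_convexOn iw
      (Φ := fun y z => Real.exp (-(γ * ‖y - p.1‖)) * ‖z - w p‖)
      (fun y => (hconv (w p)).smul (Real.exp_nonneg _)) (fun y => by fun_prop) hp2 hp1
  unfold energy
  exact add_le_add h1 (mul_le_mul_of_nonneg_left (h2.trans h3) ha)

end Averaging

/-! ### Existence of an `∞`-optimal plan -/

section OptimalPlan

variable {d : ℕ} {μ μ' : Measure (E d)}

lemma IsCoupling.isProbabilityMeasure [IsProbabilityMeasure μ] {π : Measure (E d × E d)}
    (h : IsCoupling μ μ' π) : IsProbabilityMeasure π := by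
  have : IsProbabilityMeasure (π.map Prod.fst) := h.1 ▸ inferInstance
  exact Measure.isProbabilityMeasure_of_map Prod.fst

/-- The cost exceeds a level when the open set where `edist` does has positive mass, and by the
portmanteau theorem this persists under weak perturbation. -/
lemma lowerSemicontinuous_supCost :
    LowerSemicontinuous fun π : ProbabilityMeasure (E d × E d) =>
      supCost (π : Measure (E d × E d)) := by
  intro π y hy
  obtain ⟨z, hyz, hz⟩ := exists_between hy
  have hG : IsOpen {p : E d × E d | z < edist p.1 p.2} :=
    isOpen_lt continuous_const (by fun_prop)
  have hpos : 0 < (π : Measure _) {p : E d × E d | z < edist p.1 p.2} := by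
    refine pos_iff_ne_zero.2 fun h0 => hz.not_ge (essSup_le_of_ae_le _ ?_)
    filter_upwards [measure_eq_zero_iff_ae_notMem.1 h0] with p hp
    exact not_lt.1 hp
  have hlim := ProbabilityMeasure.le_liminf_measure_open_of_tendsto
    (L := nhds π) (μs := id) Filter.tendsto_id hG
  filter_upwards [Filter.eventually_lt_of_lt_liminf (hpos.trans_le hlim)] with π' hπ'
  refine hyz.trans_le (not_lt.1 fun hlt => hπ'.ne' ?_)
  refine measure_eq_zero_iff_ae_notMem.2 ?_
  filter_upwards [ae_le_essSup (μ := (π' : Measure _))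
    (f := fun p : E d × E d => edist p.1 p.2)] with p hp
  exact not_lt.2 (hp.trans hlt.le)

/-- Prokhorov: prescribed marginals are tight, hence so are the couplings; the marginal constraints
are weakly closed. -/
lemma isCompact_setOf_isCoupling [IsProbabilityMeasure μ] [IsProbabilityMeasure μ'] :
    IsCompact {π : ProbabilityMeasure (E d × E d) | IsCoupling μ μ' (π : Measure _)} := by
  have hclosed : IsClosed
      {π : ProbabilityMeasure (E d × E d) | IsCoupling μ μ' (π : Measure _)} := by
    have h1 : IsClosed {π : ProbabilityMeasure (E d × E d) |
        π.map measurable_fst.aemeasurable = (⟨μ, inferInstance⟩ : ProbabilityMeasure (E d))} :=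
      isClosed_eq (ProbabilityMeasure.continuous_map continuous_fst) continuous_const
    have h2 : IsClosed {π : ProbabilityMeasure (E d × E d) |
        π.map measurable_snd.aemeasurable = (⟨μ', inferInstance⟩ : ProbabilityMeasure (E d))} :=
      isClosed_eq (ProbabilityMeasure.continuous_map continuous_snd) continuous_const
    convert h1.inter h2 using 1
    ext π
    exact ⟨fun h => ⟨Subtype.ext h.1, Subtype.ext h.2⟩,
      fun h => ⟨congrArg Subtype.val h.1, congrArg Subtype.val h.2⟩⟩
  rw [← hclosed.closure_eq]
  refine isCompact_closure_of_isTightMeasureSet (IsTightMeasureSet.prodMk ?_ ?_)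
  · refine (isTightMeasureSet_singleton (μ := μ)).subset ?_
    rintro _ ⟨_, ⟨π, hπ, rfl⟩, rfl⟩
    exact hπ.1
  · refine (isTightMeasureSet_singleton (μ := μ')).subset ?_
    rintro _ ⟨_, ⟨π, hπ, rfl⟩, rfl⟩
    exact hπ.2

lemma exists_isOptimalPlan (μ μ' : Measure (E d)) [IsProbabilityMeasure μ]
    [IsProbabilityMeasure μ'] : ∃ π, IsOptimalPlan μ μ' π := by
  have hprod : IsCoupling μ μ' (μ.prod μ') := by
    constructor
    · rw [Measure.map_fst_prod]; simp
    · rw [Measure.map_snd_prod]; simp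
  have hne : {π : ProbabilityMeasure (E d × E d) | IsCoupling μ μ' (π : Measure _)}.Nonempty :=
    ⟨⟨μ.prod μ', inferInstance⟩, hprod⟩
  obtain ⟨π, hπ, hmin⟩ := LowerSemicontinuousOn.exists_isMinOn hne isCompact_setOf_isCoupling
    (lowerSemicontinuous_supCost.lowerSemicontinuousOn _)
  have hle : ∀ π' : ProbabilityMeasure (E d × E d), IsCoupling μ μ' (π' : Measure _) →
      supCost (π : Measure (E d × E d)) ≤ supCost (π' : Measure (E d × E d)) :=
    fun π' hπ' => isMinOn_iff.1 hmin π' hπ'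
  refine ⟨π, hπ, le_antisymm (le_iInf₂ fun π' hπ' => ?_) (iInf₂_le (π : Measure (E d × E d)) hπ)⟩
  exact hle ⟨π', hπ'.isProbabilityMeasure⟩ hπ'

end OptimalPlan

/-! ### Stability under a displacement of the positions -/

section Stability

lemma energy_le_of_norm_sub_le {Ω V : Type*} [MeasurableSpace Ω] [NormedAddCommGroup V]
    {ρ : Measure Ω} [IsProbabilityMeasure ρ] {P Q w : Ω → V} (hP : MemLp P 2 ρ) (hQ : MemLp Q 2 ρ)
    (hw : MemLp w 2 ρ) {a γ δ M : ℝ} (ha : 0 ≤ a) (hγ : 0 ≤ γ) (hδ : 0 ≤ δ)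
    (hδM : δ ≤ M) (hγδ : 2 * (γ * δ) ≤ 1) (hPQ : ∀ᵐ x ∂ρ, ‖P x - Q x‖ ≤ δ)
    (hM : energy ρ Q a γ w ≤ (M / 2) ^ 2) :
    energy ρ P a γ w ≤ energy ρ Q a γ w + 2 * (δ * max γ 1 * (M + 1) ^ 2) := by
  have iw := hw.integrable one_le_two
  have kP := integrable_weight_mul hγ hP.1 hP.1 iw iw
  have kQ := integrable_weight_mul hγ hQ.1 hQ.1 iw iw
  have iQ := integrable_normSq_sub hw hQ
  have hA : ∫ x, ‖w x - P x‖ ^ 2 ∂ρ ≤ (1 + δ) * (∫ x, ‖w x - Q x‖ ^ 2 ∂ρ) + (δ + δ ^ 2) := by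
    calc _ ≤ ∫ x, ((1 + δ) * ‖w x - Q x‖ ^ 2 + (δ + δ ^ 2)) ∂ρ := by
          refine integral_mono_ae (integrable_normSq_sub hw hP)
            ((iQ.const_mul _).add (integrable_const _)) ?_
          filter_upwards [hPQ] with x hx
          have h1 : ‖w x - P x‖ ≤ ‖w x - Q x‖ + δ := by
            rw [norm_sub_rev] at hx
            have := norm_add_le (w x - Q x) (Q x - P x)
            rw [sub_add_sub_cancel] at this
            linarith
          have h2 := pow_le_pow_left₀ (norm_nonneg _) h1 2
          -- Absorbs the cross term: `2δn ≤ δn² + δ` with `n = ‖w x - Q x‖`.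
          have h3 := mul_nonneg hδ (sq_nonneg (‖w x - Q x‖ - 1))
          linarith
      _ = _ := by
          rw [integral_add (iQ.const_mul _) (integrable_const _), integral_const_mul]
          simp
  have hB : ∫ q, Real.exp (-(γ * ‖P q.1 - P q.2‖)) * ‖w q.1 - w q.2‖ ∂(ρ.prod ρ) ≤
      Real.exp (2 * (γ * δ)) *
        ∫ q, Real.exp (-(γ * ‖Q q.1 - Q q.2‖)) * ‖w q.1 - w q.2‖ ∂(ρ.prod ρ) := by
    rw [← integral_const_mul]
    refine integral_mono_ae kP (kQ.const_mul _) ?_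
    filter_upwards [Measure.quasiMeasurePreserving_fst.ae hPQ,
      Measure.quasiMeasurePreserving_snd.ae hPQ] with q h1 h2
    rw [← mul_assoc, ← Real.exp_add]
    refine mul_le_mul_of_nonneg_right (Real.exp_le_exp.2 ?_) (norm_nonneg _)
    have h3 : ‖Q q.1 - Q q.2‖ ≤ ‖P q.1 - P q.2‖ + 2 * δ := by
      have e : Q q.1 - Q q.2 = (P q.1 - P q.2) - (P q.1 - Q q.1) + (P q.2 - Q q.2) := by abel
      rw [e]
      have n1 := norm_add_le ((P q.1 - P q.2) - (P q.1 - Q q.1)) (P q.2 - Q q.2)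
      have n2 := norm_sub_le (P q.1 - P q.2) (P q.1 - Q q.1)
      linarith
    linarith [mul_le_mul_of_nonneg_left h3 hγ]
  have hexp : Real.exp (2 * (γ * δ)) ≤ 1 + 4 * (γ * δ) := by
    have h0 : 0 ≤ 2 * (γ * δ) := by positivity
    have := Real.abs_exp_sub_one_le (x := 2 * (γ * δ)) (by rwa [abs_of_nonneg h0])
    rw [abs_of_nonneg h0] at this
    linarith [le_abs_self (Real.exp (2 * (γ * δ)) - 1)]
  unfold energy at hM ⊢
  have hA0 : 0 ≤ ∫ x, ‖w x - Q x‖ ^ 2 ∂ρ := by positivity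
  have hB0 : 0 ≤ a * ∫ q, Real.exp (-(γ * ‖Q q.1 - Q q.2‖)) * ‖w q.1 - w q.2‖ ∂(ρ.prod ρ) := by
    positivity
  have hB' := mul_le_mul_of_nonneg_left hB ha
  rw [mul_left_comm] at hB'
  set A := ∫ x, ‖w x - Q x‖ ^ 2 ∂ρ
  set B := a * ∫ q, Real.exp (-(γ * ‖Q q.1 - Q q.2‖)) * ‖w q.1 - w q.2‖ ∂(ρ.prod ρ)
  have hM0 : 0 ≤ M := hδ.trans hδM
  have hγδ0 : 0 ≤ γ * δ := by positivity
  have e1 := mul_le_mul_of_nonneg_right hexp hB0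
  have e2 : γ * δ * B ≤ γ * δ * (M / 2) ^ 2 := mul_le_mul_of_nonneg_left (by linarith) hγδ0
  have e3 : δ * A ≤ δ * (M / 2) ^ 2 := mul_le_mul_of_nonneg_left (by linarith) hδ
  have e4 : δ * δ ≤ δ * M := mul_le_mul_of_nonneg_left hδM hδ
  have e5 : δ * 1 * (M + 1) ^ 2 ≤ δ * max γ 1 * (M + 1) ^ 2 := by gcongr; exact le_max_right _ _
  have e6 : δ * γ * (M + 1) ^ 2 ≤ δ * max γ 1 * (M + 1) ^ 2 := by gcongr; exact le_max_left _ _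
  have e7 : 0 ≤ δ * M := by positivity
  have e8 : 0 ≤ γ * δ * M := by positivity
  have e9 : 0 ≤ δ * M ^ 2 := by positivity
  linarith

variable {d : ℕ} {μ μ' : Measure (E d)} {lam γ : ℝ}

/-- Here `w` may depend on both coordinates; its fibre average is a competitor for `u` of no larger
energy. This admits the midpoint of the two lifted minimizers. -/
lemma IsMinimizer.le_energy_fst [IsProbabilityMeasure μ] (hlam : 0 ≤ lam) (hγ : 0 ≤ γ)
    (hid : MemLp (id : E d → E d) 2 μ) {u : L2 μ} (hu : IsMinimizer μ lam γ u)
    {π : Measure (E d × E d)} (hπ : MeasurePreserving Prod.fst π μ)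
    {w : E d × E d → E d} (hw : MemLp w 2 π) :
    energy μ id (lam * γ ^ (d + 1)) γ u ≤ energy π Prod.fst (lam * γ ^ (d + 1)) γ w := by
  have hfst : π.fst = μ := hπ.map_eq
  have : IsProbabilityMeasure (π.map Prod.fst) := hπ.map_eq ▸ inferInstance
  have : IsProbabilityMeasure π := Measure.isProbabilityMeasure_of_map Prod.fst
  subst hfst
  exact (hu.le_of_memLp hγ (memLp_integral_condKernel hw)).trans
    (energy_integral_condKernel_le (by positivity) hγ hid hw)

lemma IsMinimizer.le_energy_snd [IsProbabilityMeasure μ] (hlam : 0 ≤ lam) (hγ : 0 ≤ γ)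
    (hid : MemLp (id : E d → E d) 2 μ) {u : L2 μ} (hu : IsMinimizer μ lam γ u)
    {π : Measure (E d × E d)} [SFinite π] (hπ : MeasurePreserving Prod.snd π μ)
    {w : E d × E d → E d} (hw : MemLp w 2 π) :
    energy μ id (lam * γ ^ (d + 1)) γ u ≤ energy π Prod.snd (lam * γ ^ (d + 1)) γ w := by
  have hswap : MeasurePreserving Prod.swap π (π.map Prod.swap) := ⟨measurable_swap, rfl⟩
  have hswap' : MeasurePreserving Prod.swap (π.map Prod.swap) π := by
    refine ⟨measurable_swap, ?_⟩
    rw [Measure.map_map measurable_swap measurable_swap, Prod.swap_swap_eq, Measure.map_id]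
  have hw' : MemLp (w ∘ Prod.swap) 2 (π.map Prod.swap) := hw.comp_measurePreserving hswap'
  refine (hu.le_energy_fst hlam hγ hid (hπ.comp hswap') hw').trans_eq ?_
  exact energy_comp hswap' _ _ measurable_snd.aestronglyMeasurable hw.1

/-- Minimizers of two measures coupled by a plan that moves every point by at most `δ` are close
in `L²` of the plan. -/
lemma integral_normSq_sub_le_of_isMinimizer [IsProbabilityMeasure μ] [IsProbabilityMeasure μ']
    {M δ : ℝ} {c : E d} (hlam : 0 ≤ lam) (hγ : 0 ≤ γ) (hδ : 0 ≤ δ) (hδM : δ ≤ M)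
    (hμ : ∀ᵐ x ∂μ, ‖c - x‖ ≤ M / 2) (hμ' : ∀ᵐ x ∂μ', ‖c - x‖ ≤ M / 2)
    {π : Measure (E d × E d)} (hfst : MeasurePreserving Prod.fst π μ)
    (hsnd : MeasurePreserving Prod.snd π μ') (hπ : ∀ᵐ p ∂π, ‖p.1 - p.2‖ ≤ δ)
    {u : L2 μ} {u' : L2 μ'} (hu : IsMinimizer μ lam γ u) (hu' : IsMinimizer μ' lam γ u') :
    ∫ p, ‖u p.1 - u' p.2‖ ^ 2 ∂π ≤ 10 * (M + 1) ^ 2 * max γ 1 * δ := by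
  have hprob : IsProbabilityMeasure π := IsCoupling.isProbabilityMeasure ⟨hfst.map_eq, hsnd.map_eq⟩
  have hid := memLp_id_of_ae_le hμ
  have hid' := memLp_id_of_ae_le hμ'
  have hP : MemLp (Prod.fst : E d × E d → E d) 2 π := hid.comp_measurePreserving hfst
  have hQ : MemLp (Prod.snd : E d × E d → E d) 2 π := hid'.comp_measurePreserving hsnd
  have hw : MemLp (u ∘ Prod.fst) 2 π := (Lp.memLp u).comp_measurePreserving hfst
  have hw' : MemLp (u' ∘ Prod.snd) 2 π := (Lp.memLp u').comp_measurePreserving hsnd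
  set a := lam * γ ^ (d + 1) with ha_def
  have ha : 0 ≤ a := by positivity
  have hM0 : 0 ≤ M := hδ.trans hδM
  have hE : energy π Prod.fst a γ (u ∘ Prod.fst) = energy μ id a γ u :=
    energy_comp hfst a γ hid.1 (Lp.memLp u).1
  have hE' : energy π Prod.snd a γ (u' ∘ Prod.snd) = energy μ' id a γ u' :=
    energy_comp hsnd a γ hid'.1 (Lp.memLp u').1
  have hb := hu.energy_le hγ hμ
  have hb' := hu'.energy_le hγ hμ'
  rw [← ha_def, ← hE] at hb
  rw [← ha_def, ← hE'] at hb'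
  -- Write `K = δ max(γ,1) (M+1)²`. For small `γδ`, each change of positions costs `2K`, so the
  -- first energies of the two fields differ by at most `4K`, and convexity gives `8K`.
  by_cases hsmall : 2 * (γ * δ) ≤ 1
  · have h1 := hu.le_energy_fst hlam hγ hid hfst ((hw.add hw').const_smul (2⁻¹ : ℝ))
    have h2 := energy_midpoint_le ha hγ hP hw hw'
    have h3 := energy_le_of_norm_sub_le hP hQ hw' ha hγ hδ hδM hsmall hπ hb'
    have h4 := energy_le_of_norm_sub_le hQ hP hw ha hγ hδ hδM hsmall
      (by simpa only [norm_sub_rev] using hπ) hb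
    have h5 := hu'.le_energy_snd hlam hγ hid' hsnd hw
    rw [← ha_def, ← hE] at h1
    rw [← ha_def, ← hE'] at h5
    have h6 := h1.trans h2
    have h7 : 0 ≤ δ * max γ 1 * (M + 1) ^ 2 := by positivity
    simp only [Function.comp_apply] at h6
    linarith
  -- Now `(M+1)² ≤ 2K`, so going from `u` to `u'` through the two positions suffices: the bound is
  -- `3M²/4 + 3M²/4 + 3M² ≤ 9K`.
  · have iA := integrable_normSq_sub hw hP
    have iA' := integrable_normSq_sub hw' hQ
    have hA := (integral_normSq_le_energy π Prod.fst ha γ (u ∘ Prod.fst)).trans hb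
    have hA' := (integral_normSq_le_energy π Prod.snd ha γ (u' ∘ Prod.snd)).trans hb'
    have hD : ∫ p, ‖u p.1 - u' p.2‖ ^ 2 ∂π ≤ 3 * (∫ p, ‖(u ∘ Prod.fst) p - p.1‖ ^ 2 ∂π) +
        3 * (∫ p, ‖(u' ∘ Prod.snd) p - p.2‖ ^ 2 ∂π) + 3 * δ ^ 2 := by
      calc _ ≤ ∫ p, (3 * ‖(u ∘ Prod.fst) p - p.1‖ ^ 2 + 3 * ‖(u' ∘ Prod.snd) p - p.2‖ ^ 2 +
              3 * δ ^ 2) ∂π := by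
            refine integral_mono_ae (integrable_normSq_sub hw hw')
              (((iA.const_mul 3).add (iA'.const_mul 3)).add (integrable_const _)) ?_
            filter_upwards [hπ] with p hp
            simp only [Function.comp_apply]
            have e : u p.1 - u' p.2 = (u p.1 - p.1) - (u' p.2 - p.2) + (p.1 - p.2) := by abel
            have n1 := norm_add_le ((u p.1 - p.1) - (u' p.2 - p.2)) (p.1 - p.2)
            have n2 := norm_sub_le (u p.1 - p.1) (u' p.2 - p.2)
            rw [← e] at n1
            have n3 : ‖u p.1 - u' p.2‖ ≤ ‖u p.1 - p.1‖ + ‖u' p.2 - p.2‖ + δ := by linarith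
            have n4 := pow_le_pow_left₀ (norm_nonneg _) n3 2
            nlinarith [sq_nonneg (‖u p.1 - p.1‖ - ‖u' p.2 - p.2‖),
              sq_nonneg (‖u p.1 - p.1‖ - δ), sq_nonneg (‖u' p.2 - p.2‖ - δ)]
        _ = _ := by
            rw [integral_add (f := fun p => 3 * ‖(u ∘ Prod.fst) p - p.1‖ ^ 2 +
                3 * ‖(u' ∘ Prod.snd) p - p.2‖ ^ 2)
              ((iA.const_mul 3).add (iA'.const_mul 3)) (integrable_const _),
              integral_add (iA.const_mul 3) (iA'.const_mul 3), integral_const_mul,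
              integral_const_mul]
            simp
    have h1 : δ ^ 2 ≤ M ^ 2 := pow_le_pow_left₀ hδ hδM 2
    have h2 : 1 ≤ 2 * (max γ 1 * δ) :=
      (not_le.1 hsmall).le.trans (by gcongr; exact le_max_left _ _)
    have h3 : (M + 1) ^ 2 * 1 ≤ (M + 1) ^ 2 * (2 * (max γ 1 * δ)) :=
      mul_le_mul_of_nonneg_left h2 (sq_nonneg _)
    linarith [sq_nonneg M]

end Stability

end SumOfNorms

theorem proposition3p1 :
    ∃ C : ℝ, ∀ (d : ℕ) (γ lam M : ℝ), 0 < γ → 0 < lam → 0 < M →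
      ∀ (μ μ' : Measure (SumOfNorms.E d)) [IsProbabilityMeasure μ] [IsProbabilityMeasure μ']
        (c : SumOfNorms.E d),
        μ.support ⊆ Metric.closedBall c (M / 2) →
        μ'.support ⊆ Metric.closedBall c (M / 2) →
        -- the minimizers exist and are unique
        (∃! u : SumOfNorms.L2 μ, SumOfNorms.IsMinimizer μ lam γ u) ∧
        (∃! u' : SumOfNorms.L2 μ', SumOfNorms.IsMinimizer μ' lam γ u') ∧
        ∃ π : Measure (SumOfNorms.E d × SumOfNorms.E d),
          SumOfNorms.IsOptimalPlan μ μ' π ∧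
          ∀ (u : SumOfNorms.L2 μ) (u' : SumOfNorms.L2 μ'),
            SumOfNorms.IsMinimizer μ lam γ u → SumOfNorms.IsMinimizer μ' lam γ u' →
            Integrable (fun p => ‖u p.1 - u' p.2‖ ^ 2) π ∧
            ∫ p, ‖u p.1 - u' p.2‖ ^ 2 ∂π
              ≤ C * (M + 1) ^ 2 * max γ 1 * (SumOfNorms.winfty μ μ').toReal := by
  -- Any constant above the `8` and `9` of the two regimes would do.
  refine ⟨10, fun d γ lam M hγ hlam hM μ μ' _ _ c hμ hμ' => ?_⟩
  have bμ := SumOfNorms.ae_mem_of_support_subset hμ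
  have bμ' := SumOfNorms.ae_mem_of_support_subset hμ'
  refine ⟨SumOfNorms.existsUnique_isMinimizer hγ.le hlam.le (SumOfNorms.memLp_id_of_ae_le bμ),
    SumOfNorms.existsUnique_isMinimizer hγ.le hlam.le (SumOfNorms.memLp_id_of_ae_le bμ'), ?_⟩
  obtain ⟨π, hπ, hopt⟩ := SumOfNorms.exists_isOptimalPlan μ μ'
  have hfst : MeasurePreserving Prod.fst π μ := ⟨measurable_fst, hπ.1⟩
  have hsnd : MeasurePreserving Prod.snd π μ' := ⟨measurable_snd, hπ.2⟩
  -- Both points of a pair lie almost surely within `M / 2` of `c`.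
  have hle : SumOfNorms.winfty μ μ' ≤ ENNReal.ofReal M := by
    rw [← hopt]
    refine essSup_le_of_ae_le _ ?_
    filter_upwards [hfst.quasiMeasurePreserving.ae bμ, hsnd.quasiMeasurePreserving.ae bμ']
      with p h1 h2
    rw [edist_dist]
    refine ENNReal.ofReal_le_ofReal ((dist_triangle_left p.1 p.2 c).trans ?_)
    rw [dist_eq_norm, dist_eq_norm]
    linarith
  have hfin : SumOfNorms.winfty μ μ' ≠ ∞ := ne_top_of_le_ne_top ENNReal.ofReal_ne_top hle
  have hdist : ∀ᵐ p ∂π, ‖p.1 - p.2‖ ≤ (SumOfNorms.winfty μ μ').toReal := by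
    filter_upwards [ae_le_essSup (μ := π)
      (f := fun p : SumOfNorms.E d × SumOfNorms.E d => edist p.1 p.2)] with p hp
    rw [← dist_eq_norm, dist_edist]
    exact ENNReal.toReal_mono hfin (hp.trans_eq hopt)
  refine ⟨π, ⟨hπ, hopt⟩, fun u u' hu hu' => ⟨?_, ?_⟩⟩
  · exact SumOfNorms.integrable_normSq_sub ((Lp.memLp u).comp_measurePreserving hfst)
      ((Lp.memLp u').comp_measurePreserving hsnd)
  · exact SumOfNorms.integral_normSq_sub_le_of_isMinimizer hlam.le hγ.le ENNReal.toReal_nonneg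
      (ENNReal.toReal_le_of_le_ofReal hM.le hle) bμ bμ' hfst hsnd hdist hu hu'
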